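/- Let $M$ be a monoid. For $x\in M$ write $MxM=\{axb : a,b\in M\}$; the $\mathcal{J}$-class of the identity is $\{x\in M : MxM=M1M\}$. Suppose that the $\mathcal{J}$-class of the identity of $M$ is (under the multiplication of $M$) a sofic group $G$, and suppose that for every orbit $O\subseteq M\setminus G$ of the right translation action $(s,g)\mapsto sg$ of $G$ on $M\setminus G$, the quotient $G/H_O$ of $G$ by the (normal) pointwise stabiliser $H_O=\{g\in G : yg=y \text{ for all } y\in O\}$ of $O$ is an amenable group. Then $M$ is sofic. Here: - a monoid $M$ is *sofic* (in the sense of Ceccherini-Silberstein and Coornaert) if for every finite subset $K\subseteq M$ and every $\varepsilon>0$ there are a non-empty finite set $X$ and a map $M\times X\to X$, $(m,x)\mapsto m\cdot x$, such that $1\cdot x=x$ for all $x\in X$; for all $g,h\in K$ the proportion of $x\in X$ with $g\cdot(h\cdot x)=(gh)\cdot x$ is at least $1-\varepsilon$; and for all $g,h\in K$ with $g\neq h$ the proportion of $x\in X$ with $g\cdot x=h\cdot x$ is at most $\varepsilon$; - a group $G$ is *sofic* if for every finite subset $K\subseteq G$ and every $\varepsilon>0$ there are a non-empty finite set $X$ and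 a map $\varphi:G\to\mathrm{Sym}(X)$ such that $d(\varphi(gh),\varphi(g)\varphi(h))\le\varepsilon$ for all $g,h\in K$, and $d(\varphi(g),\varphi(h))\ge 1-\varepsilon$ for all $g,h\in K$ with $g\ne h$, where $d(\sigma,\tau)$ is the proportion of $x\in X$ with $\sigma(x)\neq\tau(x)$; - a group is *amenable* if it admits a finitely additive probability measure, defined on all of its subsets, that is invariant under left translation. -/

import Mathlib

/-- The proportion of the elements of a (finite, nonempty) set `X` that satisfy `P`. -/
noncomputable def proportion (X : Type) (P : X → Prop) : ℝ :=
  (Nat.card {x : X // P x} : ℝ) / (Nat.card X : ℝ)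

/-- A map `M × X → X` is a (left) `(K, ε)`-action of the monoid `M` on the set `X`. -/
structure IsApproxAction {M : Type*} [Monoid M] (K : Finset M) (ε : ℝ) (X : Type)
    (act : M → X → X) : Prop where
  one_act : ∀ x : X, act 1 x = x
  almost_mul : ∀ g ∈ K, ∀ h ∈ K,
    1 - ε ≤ proportion X (fun x => act g (act h x) = act (g * h) x)
  almost_free : ∀ g ∈ K, ∀ h ∈ K, g ≠ h →
    proportion X (fun x => act g x = act h x) ≤ ε

/-- (Left) sofic monoids, in the sense of Ceccherini-Silberstein and Coornaert. -/
def IsSoficMonoid (M : Type*) [Monoid M] : Prop :=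
  ∀ (K : Finset M) (ε : ℝ), 0 < ε →
    ∃ X : Type, Finite X ∧ Nonempty X ∧ ∃ act : M → X → X, IsApproxAction K ε X act

/-- The normalised Hamming distance on the permutations of a finite nonempty set. -/
noncomputable def permDist {X : Type} (σ τ : Equiv.Perm X) : ℝ :=
  proportion X (fun x => σ x ≠ τ x)

/-- Sofic groups, through almost homomorphisms to finite symmetric groups. -/
def IsSoficGroup (G : Type*) [Group G] : Prop :=
  ∀ (K : Finset G) (ε : ℝ), 0 < ε →
    ∃ X : Type, Finite X ∧ Nonempty X ∧ ∃ φ : G → Equiv.Perm X,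
      (∀ g ∈ K, ∀ h ∈ K, permDist (φ (g * h)) (φ g * φ h) ≤ ε) ∧
      (∀ g ∈ K, ∀ h ∈ K, g ≠ h → 1 - ε ≤ permDist (φ g) (φ h))

/-- Amenable groups: there is a finitely additive probability measure on all subsets that is
invariant under left translation. -/
def IsAmenableGroup (G : Type*) [Group G] : Prop :=
  ∃ μ : Set G → ℝ,
    (∀ A, 0 ≤ μ A) ∧ μ Set.univ = 1 ∧
    (∀ A B, Disjoint A B → μ (A ∪ B) = μ A + μ B) ∧
    (∀ (g : G) (A : Set G), μ ((fun x => g * x) '' A) = μ A)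

/-- The two-sided principal ideal `M x M`. -/
def principalIdeal {M : Type*} [Monoid M] (x : M) : Set M :=
  {z | ∃ a b : M, z = a * x * b}

/-- The class of `x` under Green's relation `𝒥`, where `y 𝒥 x` means `M y M = M x M`. -/
def greenJClass {M : Type*} [Monoid M] (x : M) : Set M :=
  {y | principalIdeal y = principalIdeal x}

/-- The pointwise stabiliser in `G` of the orbit of `x`, for a right action of `G` on `X`
(that is, an action of the opposite group of `G`). -/
def orbitStabiliser (G : Type*) {X : Type*} [Group G] [MulAction Gᵐᵒᵖ X] (x : X) :
    Subgroup G :=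
  (fixingSubgroup Gᵐᵒᵖ (MulAction.orbit Gᵐᵒᵖ x)).unop

theorem mem_orbitStabiliser {G X : Type*} [Group G] [MulAction Gᵐᵒᵖ X] {x : X} {g : G} :
    g ∈ orbitStabiliser G x ↔
      ∀ y ∈ MulAction.orbit Gᵐᵒᵖ x, MulOpposite.op g • y = y := by
  rw [orbitStabiliser, Subgroup.mem_unop, mem_fixingSubgroup_iff]

instance orbitStabiliser_normal (G : Type*) {X : Type*} [Group G] [MulAction Gᵐᵒᵖ X] (x : X) :
    (orbitStabiliser G x).Normal where
  conj_mem n hn g := by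
    rw [mem_orbitStabiliser] at hn ⊢
    intro y hy
    have h := hn (MulOpposite.op g • y) (MulAction.mem_orbit_of_mem_orbit _ hy)
    rw [MulOpposite.op_mul, MulOpposite.op_mul, mul_smul, mul_smul, h, ← mul_smul,
      ← MulOpposite.op_mul, mul_inv_cancel, MulOpposite.op_one, one_smul]

/-- A right action of `G` on `X` is locally amenable if, for every orbit, the quotient of `G` by
the pointwise stabiliser of the orbit is an amenable group. -/
def IsLocallyAmenable (G X : Type*) [Group G] [MulAction Gᵐᵒᵖ X] : Prop :=
  ∀ x : X, IsAmenableGroup (G ⧸ orbitStabiliser G x)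

/-- The complement `M \ G`, where the group `G` is embedded in the monoid `M` by `ι`. -/
abbrev Outside {M G : Type*} [Monoid M] [Group G] (ι : G →* M) : Type _ :=
  {s : M // s ∉ Set.range ι}

/-- The right translation action `(s, g) ↦ s g` of `G` on `M \ G`. -/
instance rightTranslation {M G : Type*} [Monoid M] [Group G] (ι : G →* M) :
    MulAction Gᵐᵒᵖ (Outside ι) where
  smul g s := ⟨s.1 * ι g.unop, by
    rintro ⟨h, hh⟩
    refine s.2 ⟨h * g.unop⁻¹, ?_⟩
    rw [map_mul, hh, mul_assoc, ← map_mul, mul_inv_cancel, map_one, mul_one]⟩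
  one_smul s := Subtype.ext (by
    change s.1 * ι 1 = s.1
    rw [map_one, mul_one])
  mul_smul g h s := Subtype.ext (by
    change s.1 * ι (h.unop * g.unop) = s.1 * ι h.unop * ι g.unop
    rw [map_mul, mul_assoc])

/-! Elements outside the `𝒥`-class of 1 form a two-sided ideal, so a product is a unit from `G` only
if both factors are. The model is `X × F × C ⊕ B`. Here `X` is a sofic approximation of `G`, and `F`
is a Følner set in the product of the amenable quotients `G ⧸ H i`, one for each of the finitely
many outside elements that occur. Units act on `X × F`. An outside `m` sends `(x, y, c)` to `m * u
y` in the finite set `B ⊆ M`. The relation `m * u (g • y) = m * g * u y` makes this compatible with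
units; it holds because `u` is equivariant modulo the stabilisers (`exists_equivariant_pi`). A large
`C` makes `B` negligible, so its points may all be bad. The model is checked in `modelAct_mul` and
`modelAct_ne`. -/

open scoped Pointwise

/-! ### Amenability implies the Følner condition -/

/-- The Følner condition: every finite set of translations almost preserves some finite set. -/
def IsFolnerGroup (G : Type*) [Group G] : Prop :=
  ∀ (S : Finset G) (ε : ℝ), 0 < ε → ∃ F : Finset G, F.Nonempty ∧
    ∀ s ∈ S, ({y : F | s * (y : G) ∉ F}.ncard : ℝ) ≤ ε * F.card

/-- A finitely additive set function is additive over finite disjoint families. -/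
theorem finitelyAdditive_biUnion {α ι : Type*} {μ : Set α → ℝ} (h0 : μ ∅ = 0)
    (hadd : ∀ A B, Disjoint A B → μ (A ∪ B) = μ A + μ B) (T : Finset ι) (A : ι → Set α)
    (hA : ∀ i ∈ T, ∀ j ∈ T, i ≠ j → Disjoint (A i) (A j)) :
    μ (⋃ i ∈ T, A i) = ∑ i ∈ T, μ (A i) := by
  classical
  induction T using Finset.induction_on with
  | empty => simpa using h0
  | insert a T ha ih =>
    rw [Finset.set_biUnion_insert, Finset.sum_insert ha, hadd, ih]
    · exact fun i hi j hj => hA i (Finset.mem_insert_of_mem hi) j (Finset.mem_insert_of_mem hj)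
    · simp only [Set.disjoint_iUnion_right]
      intro i hi
      exact hA a (Finset.mem_insert_self _ _) i (Finset.mem_insert_of_mem hi)
        (fun h => ha (h ▸ hi))

/-- An amenable group has no finite set that doubles the size of all finite sets. -/
theorem IsAmenableGroup.exists_card_mul_lt {G : Type*} [Group G] [DecidableEq G]
    (hG : IsAmenableGroup G) (T : Finset G) :
    ∃ F : Finset G, (T * F).card < 2 * F.card := by
  by_contra! hT
  obtain ⟨μ, hpos, huniv, hadd, hinv⟩ := hG
  have h0 : μ ∅ = 0 := by
    have := hadd ∅ ∅ (by simp)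
    simp only [Set.union_self] at this
    linarith
  have hmono : ∀ A, μ A ≤ 1 := fun A => by
    have := hadd A Aᶜ disjoint_compl_right
    rw [Set.union_compl_self, huniv] at this
    linarith [hpos Aᶜ]
  -- Doubling is Hall's condition for two copies of `G`; a matching `f (x, i) ∈ T * {x}` is a
  -- paradoxical decomposition.
  have hall : ∀ A : Finset (G × Bool), A.card ≤ (A.biUnion fun p => T * {p.1}).card := by
    intro A
    have h1 : A.card ≤ 2 * (A.image Prod.fst).card := by
      have : A ⊆ A.image Prod.fst ×ˢ Finset.univ := fun p hp =>
        Finset.mem_product.2 ⟨Finset.mem_image_of_mem _ hp, Finset.mem_univ _⟩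
      simpa [mul_comm] using Finset.card_le_card this
    refine h1.trans ((hT _).trans (Finset.card_le_card ?_))
    intro z hz
    obtain ⟨t, ht, x, hx, rfl⟩ := Finset.mem_mul.1 hz
    obtain ⟨p, hp, rfl⟩ := Finset.mem_image.1 hx
    exact Finset.mem_biUnion.2 ⟨p, hp, Finset.mul_mem_mul ht (Finset.mem_singleton_self _)⟩
  obtain ⟨f, hf, hfT⟩ := (Finset.all_card_le_biUnion_card_iff_exists_injective _).1 hall
  have hfT' : ∀ p, ∃ t ∈ T, t * p.1 = f p := fun p => by
    obtain ⟨t, ht, x, hx, h⟩ := Finset.mem_mul.1 (hfT p)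
    rw [Finset.mem_singleton] at hx
    exact ⟨t, ht, hx ▸ h⟩
  choose τ hτ hτf using hfT'
  -- For each `i` the sets `A (i, t)` partition `G`, while all translates `t * A (i, t)` are
  -- disjoint since `f` is injective. Their total mass would be 2.
  let A : Bool × G → Set G := fun q => {x | τ (x, q.1) = q.2}
  have hsum : ∀ i, ∑ t ∈ T, μ (A (i, t)) = 1 := by
    intro i
    rw [← finitelyAdditive_biUnion h0 hadd, ← huniv]
    · congr 1
      ext x
      simp [A, hτ]
    · intro t _ t' _ htt'
      exact Set.disjoint_left.2 fun x hx hx' => htt' (hx.symm.trans hx')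
  have hle := hmono (⋃ q ∈ (Finset.univ : Finset Bool) ×ˢ T, (fun x => q.2 * x) '' A q)
  rw [finitelyAdditive_biUnion h0 hadd] at hle
  · simp only [hinv] at hle
    rw [Finset.sum_product, Finset.sum_congr rfl fun i _ => hsum i] at hle
    norm_num at hle
  · rintro ⟨i, t⟩ _ ⟨j, t'⟩ _ hne
    refine Set.disjoint_left.2 ?_
    rintro _ ⟨x, hx, rfl⟩ ⟨x', hx', h⟩
    have hx : τ (x, i) = t := hx
    have hx' : τ (x', j) = t' := hx'
    have h : t' * x' = t * x := h
    have h1 : f (x', j) = f (x, i) := by rw [← hτf, ← hτf, hx, hx', h]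
    obtain ⟨rfl, rfl⟩ := Prod.mk.inj (hf h1)
    exact hne (by rw [← hx, ← hx'])

theorem ncard_mul_notMem_le {G : Type*} [Group G] [DecidableEq G] (s : G) (F : Finset G) :
    {y : F | s * (y : G) ∉ F}.ncard ≤ ((s • F) \ F).card := by
  rw [← Set.ncard_coe_finset]
  refine Set.ncard_le_ncard_of_injOn (fun y : F => s * (y : G)) (fun y hy => ?_)
    (fun y _ z _ h => Subtype.ext (mul_left_cancel h))
  rw [Finset.mem_coe, Finset.mem_sdiff]
  exact ⟨Finset.smul_mem_smul_finset y.2, hy⟩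

/-- Amenable groups satisfy the Følner condition. -/
theorem IsAmenableGroup.isFolnerGroup {G : Type*} [Group G] (hG : IsAmenableGroup G) :
    IsFolnerGroup G := by
  classical
  intro S ε hε
  by_contra! hS
  -- If Følner fails, some translate always adds more than `ε * F.card` new points; iterating
  -- exceeds any factor, in particular 2.
  have hgrow : ∀ F : Finset G, (1 + ε) * F.card ≤ ((insert 1 S * F).card : ℝ) := by
    intro F
    rcases F.eq_empty_or_nonempty with rfl | hF
    · simp
    obtain ⟨s, hs, hlt⟩ := hS F hF
    replace hlt := hlt.trans_le (Nat.cast_le.2 (ncard_mul_notMem_le s F))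
    have hsub : F ∪ ((s • F) \ F) ⊆ insert 1 S * F := by
      refine Finset.union_subset (fun x hx => ?_) (fun x hx => ?_)
      · exact Finset.mem_mul.2 ⟨1, Finset.mem_insert_self _ _, x, hx, one_mul x⟩
      · obtain ⟨y, hy, rfl⟩ := Finset.mem_smul_finset.1 (Finset.mem_sdiff.1 hx).1
        exact Finset.mul_mem_mul (Finset.mem_insert_of_mem hs) hy
    have := Finset.card_le_card hsub
    rw [Finset.card_union_of_disjoint Finset.disjoint_sdiff] at this
    have : (F.card : ℝ) + ((s • F) \ F).card ≤ (insert 1 S * F).card := mod_cast this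
    linarith
  have hpow : ∀ (n : ℕ) (F : Finset G),
      (1 + ε) ^ n * F.card ≤ (((insert 1 S) ^ n * F).card : ℝ) := by
    intro n
    induction n with
    | zero => simp
    | succ n ih =>
      intro F
      rw [pow_succ, pow_succ, mul_assoc, mul_assoc]
      exact (mul_le_mul_of_nonneg_left (hgrow F) (by positivity)).trans (ih _)
  obtain ⟨n, hn⟩ := pow_unbounded_of_one_lt (2 : ℝ) (show 1 < 1 + ε by linarith)
  obtain ⟨F, hF⟩ := hG.exists_card_mul_lt ((insert 1 S) ^ n)
  have h1 : (((insert 1 S) ^ n * F).card : ℝ) < 2 * F.card := mod_cast hF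
  have h2 := mul_le_mul_of_nonneg_right hn.le (Nat.cast_nonneg (α := ℝ) F.card)
  linarith [hpow n F]

/-! ### Union bounds and bad sets in products -/

theorem ncard_biUnion_le_mul {X ι : Type*} [Finite X] (T : Finset ι) (A : ι → Set X) {δ ε : ℝ}
    (hA : ∀ t ∈ T, ((A t).ncard : ℝ) ≤ δ * Nat.card X) (hδ : T.card * δ ≤ ε) :
    ({x | ∃ t ∈ T, x ∈ A t}.ncard : ℝ) ≤ ε * Nat.card X := by
  have h1 : ({x | ∃ t ∈ T, x ∈ A t}.ncard : ℝ) ≤ ∑ t ∈ T, ((A t).ncard : ℝ) := by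
    have : {x | ∃ t ∈ T, x ∈ A t} = ⋃ t ∈ T, A t := by ext; simp
    rw [this]
    exact_mod_cast Finset.set_ncard_biUnion_le T A
  refine h1.trans ((Finset.sum_le_sum hA).trans ?_)
  rw [Finset.sum_const, nsmul_eq_mul, ← mul_assoc]
  exact mul_le_mul_of_nonneg_right hδ (Nat.cast_nonneg _)

theorem ncard_preimage_fst_le {X Y : Type*} [Finite X] [Finite Y] (W : Set X) {ε : ℝ}
    (hW : (W.ncard : ℝ) ≤ ε * Nat.card X) :
    ((Prod.fst ⁻¹' W : Set (X × Y)).ncard : ℝ) ≤ ε * Nat.card (X × Y) := by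
  rw [← Set.prod_univ, Set.ncard_prod, Set.ncard_univ, Nat.card_prod]
  push_cast
  rw [← mul_assoc]
  exact mul_le_mul_of_nonneg_right hW (Nat.cast_nonneg _)

theorem ncard_preimage_equiv {X Y : Type*} (e : X ≃ Y) (W : Set Y) :
    (e ⁻¹' W).ncard = W.ncard := by
  rw [← Set.ncard_image_of_injective _ e.injective, e.image_preimage]

theorem ncard_preimage_snd_le {X Y : Type*} [Finite X] [Finite Y] (W : Set Y) {ε : ℝ}
    (hW : (W.ncard : ℝ) ≤ ε * Nat.card Y) :
    ((Prod.snd ⁻¹' W : Set (X × Y)).ncard : ℝ) ≤ ε * Nat.card (X × Y) := by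
  have h := ncard_preimage_fst_le (Y := X) W hW
  rwa [← ncard_preimage_equiv (Equiv.prodComm X Y), Nat.card_congr (Equiv.prodComm Y X)] at h

theorem ncard_preimage_eval_le {ι : Type*} [Finite ι] {X : ι → Type*} [∀ i, Finite (X i)] (i : ι)
    (W : Set (X i)) {ε : ℝ} (hW : (W.ncard : ℝ) ≤ ε * Nat.card (X i)) :
    ({x : ∀ j, X j | x i ∈ W}.ncard : ℝ) ≤ ε * Nat.card (∀ j, X j) := by
  classical
  have h := ncard_preimage_fst_le (Y := ∀ j : {j // j ≠ i}, X j) W hW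
  rwa [← ncard_preimage_equiv (Equiv.piSplitAt i X), ← Nat.card_congr (Equiv.piSplitAt i X)] at h

/-! ### Approximations of `G` and its quotients -/

/-- Over a group whose quotients by the normal subgroups `H i` are amenable, finitely many of the
quotients contain finite sets whose product is almost invariant under finitely many elements. -/
theorem exists_almost_invariant_pi {G ι : Type*} [Group G] [Finite ι] (H : ι → Subgroup G)
    [∀ i, (H i).Normal] (hH : ∀ i, IsAmenableGroup (G ⧸ H i)) (L : Finset G) {ε : ℝ}
    (hε : 0 < ε) :
    ∃ F : Set (∀ i, G ⧸ H i), F.Finite ∧ F.Nonempty ∧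
      ({y : F | ∃ g ∈ L, g • (y : ∀ i, G ⧸ H i) ∉ F}.ncard : ℝ) ≤ ε * Nat.card F := by
  classical
  have := Fintype.ofFinite ι
  let T := L ×ˢ (Finset.univ : Finset ι)
  have hT : (0 : ℝ) < T.card + 1 := by positivity
  choose F hF hFL using fun i => (hH i).isFolnerGroup (L.image (QuotientGroup.mk' (H i)))
    (ε / (T.card + 1)) (by positivity)
  let e : {y : ∀ i, G ⧸ H i | ∀ i, y i ∈ F i} ≃ ∀ i, F i :=
    Equiv.subtypePiEquivPi (p := fun i z => z ∈ F i)
  refine ⟨{y | ∀ i, y i ∈ F i}, Finite.of_equiv _ e.symm,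
    ⟨fun i => (hF i).choose, fun i => (hF i).choose_spec⟩, ?_⟩
  have h := ncard_biUnion_le_mul (X := ∀ i, F i) T
    (fun p => {y | y p.2 ∈ {z : F p.2 | p.1 • (z : G ⧸ H p.2) ∉ F p.2}})
    (δ := ε / (T.card + 1)) (ε := ε) (fun p hp => ncard_preimage_eval_le p.2 _ ?_) ?_
  · rw [← ncard_preimage_equiv e, ← Nat.card_congr e] at h
    convert h using 3
    ext y
    simp [T, e, Equiv.subtypePiEquivPi]
  · have := hFL p.2 _ (Finset.mem_image_of_mem _ (Finset.mem_product.1 hp).1)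
    rw [Nat.card_eq_finsetCard]
    convert this using 5 with z
    obtain ⟨z, hz⟩ := z
    induction z using QuotientGroup.induction_on
    rfl
  · rw [mul_div_assoc', div_le_iff₀ hT]
    nlinarith

/-- In a sofic group, the almost homomorphisms are multiplicative and free at most points. -/
theorem IsSoficGroup.exists_almost_hom {G : Type*} [Group G] (hG : IsSoficGroup G) (L : Finset G)
    {ε : ℝ} (hε : 0 < ε) :
    ∃ X : Type, Finite X ∧ Nonempty X ∧ ∃ φ : G → Equiv.Perm X,
      ({x | ∃ g ∈ L, ∃ h ∈ L,
        ¬ (φ (g * h) x = φ g (φ h x) ∧ (g ≠ h → φ g x ≠ φ h x))}.ncard : ℝ) ≤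
        ε * Nat.card X := by
  classical
  let T := L ×ˢ L
  have hT : (0 : ℝ) < T.card + 1 := by positivity
  -- Each pair contributes two bad events; the `+ 1` keeps the denominator positive.
  set δ := ε / (2 * (T.card + 1))
  have hδ0 : 0 < δ := by positivity
  obtain ⟨X, hX, hX', φ, hmul, hfree⟩ := hG L δ hδ0
  refine ⟨X, hX, hX', φ, ?_⟩
  have hc : (0 : ℝ) < Nat.card X := by exact_mod_cast Nat.card_pos
  have h := ncard_biUnion_le_mul (X := X) T
    (fun p => {x | φ (p.1 * p.2) x ≠ (φ p.1 * φ p.2) x} ∪ {x | p.1 ≠ p.2 ∧ φ p.1 x = φ p.2 x})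
    (δ := δ + δ) (ε := ε) (fun p hp => ?_) ?_
  · convert h using 3
    ext x
    simp only [T, Set.mem_ofPred_eq, Set.mem_union, Prod.exists, Finset.mem_product, not_and_or,
      Equiv.Perm.mul_apply]
    grind
  · obtain ⟨hg, hh⟩ := Finset.mem_product.1 hp
    refine (Nat.cast_le.2 (Set.ncard_union_le _ _)).trans ?_
    rw [Nat.cast_add, add_mul]
    refine add_le_add ?_ ?_
    · have := hmul _ hg _ hh
      rwa [permDist, proportion, div_le_iff₀ hc] at this
    · by_cases hne : p.1 = p.2
      · simp only [hne, ne_eq, not_true_eq_false, false_and, Set.ofPred_false, Set.ncard_empty,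
          Nat.cast_zero]
        positivity
      · have := hfree _ hg _ hh hne
        rw [permDist, proportion, le_div_iff₀ hc] at this
        have hcompl := Set.ncard_add_ncard_compl {x | φ p.1 x = φ p.2 x}
        have hcompl' : ({x | φ p.1 x = φ p.2 x}.ncard : ℝ) +
            Nat.card {x // φ p.1 x ≠ φ p.2 x} = Nat.card X := mod_cast hcompl
        simp only [ne_eq, hne, not_false_eq_true, true_and]
        linarith
  · have hδT : δ * (2 * (T.card + 1)) = ε := div_mul_cancel₀ _ (by positivity)
    linarith [hδ0]

/-! ### Equivariance modulo stabilisers, and the ideal of non-units -/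

/-- An orbit-wise choice of group elements that is equivariant modulo the stabilisers. -/
theorem exists_almost_equivariant {G Y : Type*} [Group G] [MulAction G Y] :
    ∃ (u : Y → G) (b : Y → Y), ∀ (g : G) (y : Y), b (g • y) = b y ∧ u y • b y = y := by
  have h : ∀ y : Y, ∃ k : G, k • (Quotient.mk (MulAction.orbitRel G Y) y).out = y := fun y =>
    (Setoid.symm' (MulAction.orbitRel G Y) (Quotient.mk_out (s := MulAction.orbitRel G Y) y))
  choose u hu using h
  refine ⟨u, fun y => (Quotient.mk (MulAction.orbitRel G Y) y).out, fun g y => ⟨?_, hu y⟩⟩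
  have h : MulAction.orbitRel G Y (g • y) y := ⟨g, rfl⟩
  exact congrArg Quotient.out (Quotient.sound h)

/-- A finite family of quotients has a map to the group that is equivariant modulo each of the
normal subgroups. -/
theorem exists_equivariant_pi {G ι : Type*} [Group G] (H : ι → Subgroup G) [∀ i, (H i).Normal] :
    ∃ u : (∀ i, G ⧸ H i) → G, ∀ (g : G) y i, (u (g • y))⁻¹ * (g * u y) ∈ H i := by
  obtain ⟨u, b, hu⟩ := exists_almost_equivariant (G := G) (Y := ∀ i, G ⧸ H i)
  refine ⟨u, fun g y i => ?_⟩
  -- Both elements carry the common base point `b y` to `g • y`; normality then removes the coset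
  -- representative `r`.
  have h : u (g • y) • b y = (g * u y) • b y := by
    rw [← (hu g y).1, (hu g (g • y)).2, (hu g y).1, mul_smul, (hu g y).2]
  have hi := congrFun h i
  simp only [Pi.smul_apply] at hi
  generalize b y i = z at hi
  induction z using QuotientGroup.induction_on with
  | H r =>
    have hi : ((u (g • y) * r : G) : G ⧸ H i) = ((g * u y * r : G) : G ⧸ H i) := hi
    rw [QuotientGroup.eq] at hi
    have := Subgroup.Normal.conj_mem inferInstance _ hi r
    convert this using 1
    group

/-- Regrouping `1 = a * (s * t) * b` puts 1 in the ideals of both `s` and `t`. -/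
theorem mem_greenJClass_one_of_mul {M : Type*} [Monoid M] {s t : M}
    (h : s * t ∈ greenJClass (1 : M)) :
    s ∈ greenJClass (1 : M) ∧ t ∈ greenJClass (1 : M) := by
  have h1 : (1 : M) ∈ principalIdeal (s * t) := by
    rw [show principalIdeal (s * t) = principalIdeal 1 from h]
    exact ⟨1, 1, by simp⟩
  obtain ⟨a, b, hab⟩ := h1
  have key : ∀ x c d : M, 1 = c * x * d → x ∈ greenJClass (1 : M) := by
    intro x c d hx
    ext z
    refine ⟨fun _ => ⟨z, 1, by simp⟩, fun _ => ⟨z * c, d, ?_⟩⟩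
    rw [mul_assoc, mul_assoc, ← mul_assoc c, ← hx, mul_one]
  exact ⟨key s a (t * b) (by rw [hab]; simp only [mul_assoc]),
    key t (a * s) b (by rw [hab]; simp only [mul_assoc])⟩

/-- Elements of `G` congruent modulo the stabiliser of the orbit of `s` act equally on `s`. -/
theorem mul_eq_mul_of_mem_orbitStabiliser {M G : Type*} [Monoid M] [Group G] (ι : G →* M)
    (s : Outside ι) {g h : G} (hgh : g⁻¹ * h ∈ orbitStabiliser G s) :
    s.1 * ι g = s.1 * ι h := by
  have := mem_orbitStabiliser.1 hgh (MulOpposite.op g • s) ⟨_, rfl⟩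
  have h2 : s.1 * ι g * ι (g⁻¹ * h) = s.1 * ι g := congrArg Subtype.val this
  rw [← h2, mul_assoc, ← map_mul, mul_inv_cancel_left]

/-- An approximate action on a finite set in any universe suffices for soficity; a set of bad
points of small proportion is allowed. -/
theorem IsSoficMonoid.of_ncard_bad_le {M : Type*} [Monoid M] {Z : Type*} [Finite Z] [Nonempty Z]
    (K : Finset M) {ε : ℝ} (act : M → Z → Z) (bad : Set Z)
    (hbad : (bad.ncard : ℝ) ≤ ε * Nat.card Z)
    (hone : ∀ z, act 1 z = z)
    (hmul : ∀ g ∈ K, ∀ h ∈ K, ∀ z ∉ bad, act g (act h z) = act (g * h) z)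
    (hfree : ∀ g ∈ K, ∀ h ∈ K, g ≠ h → ∀ z ∉ bad, act g z ≠ act h z) :
    ∃ X : Type, Finite X ∧ Nonempty X ∧ ∃ act : M → X → X, IsApproxAction K ε X act := by
  let e := Finite.equivFin Z
  have hc : (0 : ℝ) < Nat.card (Fin (Nat.card Z)) := by
    rw [Nat.card_fin]; exact_mod_cast Nat.card_pos
  have hbad' : ((e.symm ⁻¹' bad).ncard : ℝ) ≤ ε * Nat.card (Fin (Nat.card Z)) := by
    rwa [ncard_preimage_equiv, Nat.card_fin]
  refine ⟨Fin (Nat.card Z), inferInstance, ⟨e (Classical.arbitrary Z)⟩,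
    fun m x => e (act m (e.symm x)), fun x => by simp [hone], fun g hg h hh => ?_,
    fun g hg h hh hne => ?_⟩
  · rw [proportion, le_div_iff₀ hc]
    have h1 : (e.symm ⁻¹' bad)ᶜ.ncard ≤ Nat.card {x // e (act g (e.symm (e (act h (e.symm x))))) =
        e (act (g * h) (e.symm x))} :=
      Set.ncard_le_ncard fun x hx => by
        have := hmul g hg h hh _ hx
        change e _ = e _
        rw [e.symm_apply_apply, this]
    have h1' : ((e.symm ⁻¹' bad)ᶜ.ncard : ℝ) ≤ _ := Nat.cast_le.2 h1
    have h2 : ((e.symm ⁻¹' bad).ncard : ℝ) + (e.symm ⁻¹' bad)ᶜ.ncard =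
        Nat.card (Fin (Nat.card Z)) := mod_cast Set.ncard_add_ncard_compl _
    linarith
  · rw [proportion, div_le_iff₀ hc]
    have h1 : Nat.card {x // e (act g (e.symm x)) = e (act h (e.symm x))} ≤
        (e.symm ⁻¹' bad).ncard :=
      Set.ncard_le_ncard fun x hx => by
        by_contra hxb
        exact hfree g hg h hh hne _ hxb (e.injective hx)
    exact (Nat.cast_le.2 h1).trans hbad'

/-! ### The model action -/

section Model

open Classical in
/-- The model action on `X × F × C ⊕ B`, where units act almost as on `X × F`, and other elements
`m` send `(x, y, c)` to `m * u y` in `B`. -/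
noncomputable def modelAct {M G X C Y : Type*} [Monoid M] [Group G] [MulAction G Y] (ι : G →* M)
    (φ : G → X → X) (F : Set Y) (B : Set M) (u : Y → G) (m : M) (z : (X × F) × C ⊕ B) :
    (X × F) × C ⊕ B :=
  -- `φ 1` need not be the identity, yet 1 must act trivially at every point. The other `else z`
  -- branches are default values.
  if m = 1 then z else
    match z with
    | .inl ((x, y), c) =>
      if h : m ∈ Set.range ι then
        if hy : h.choose • (y : Y) ∈ F then .inl ((φ h.choose x, ⟨_, hy⟩), c) else z
      else if hb : m * ι (u y) ∈ B then .inr ⟨_, hb⟩ else z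
    | .inr b => if hb : m * b ∈ B then .inr ⟨_, hb⟩ else z

variable {M G X C Y : Type*} [Monoid M] [Group G] [MulAction G Y] {ι : G →* M}
  {φ : G → X → X} {F : Set Y} {B : Set M} {u : Y → G}

theorem modelAct_one (z : (X × F) × C ⊕ B) : modelAct ι φ F B u 1 z = z := by
  simp [modelAct]

theorem modelAct_unit (hι : Function.Injective ι) {g : G} {x : X} {y : F} (c : C)
    (h1 : g = 1 → φ 1 x = x) (hy : g • (y : Y) ∈ F) :
    modelAct ι φ F B u (ι g) (.inl ((x, y), c)) = .inl ((φ g x, ⟨_, hy⟩), c) := by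
  by_cases hg : g = 1
  · subst hg
    simp [modelAct, h1]
  · have hg' : ι g ≠ 1 := fun h => hg (hι (h.trans (map_one ι).symm))
    have h : ι g ∈ Set.range ι := ⟨g, rfl⟩
    have hch : h.choose = g := hι h.choose_spec
    simp [modelAct, hg', hch, hy]

theorem modelAct_outside {m : M} (hm : m ∉ Set.range ι) (x : X) (y : F) (c : C)
    (hb : m * ι (u y) ∈ B) :
    modelAct ι φ F B u m (.inl ((x, y), c)) = .inr ⟨_, hb⟩ := by
  have h1 : m ≠ 1 := fun h => hm ⟨1, by rw [h, map_one]⟩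
  simp only [modelAct, h1, hm, hb, if_false, dif_pos, dif_neg, not_false_eq_true]

theorem modelAct_inr {m : M} (b : B) (hb : m * (b : M) ∈ B) :
    modelAct ι φ F B u m (.inr b : (X × F) × C ⊕ B) = .inr ⟨_, hb⟩ := by
  by_cases h1 : m = 1
  · subst h1
    simp [modelAct]
  · simp [modelAct, h1, hb]

/-- The points of `X × F` at which the unit action fails for elements of `L`. -/
def modelBad (φ : G → X → X) (F : Set Y) (L : Finset G) : Set (X × F) :=
  {p | (∃ g ∈ L, ∃ h ∈ L, ¬ (φ (g * h) p.1 = φ g (φ h p.1) ∧ (g ≠ h → φ g p.1 ≠ φ h p.1))) ∨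
    ∃ g ∈ L, g • (p.2 : Y) ∉ F}

theorem of_notMem_modelBad {L : Finset G} {p : X × F} (hp : p ∉ modelBad φ F L) :
    (∀ g ∈ L, ∀ h ∈ L, φ (g * h) p.1 = φ g (φ h p.1) ∧ (g ≠ h → φ g p.1 ≠ φ h p.1)) ∧
      ∀ g ∈ L, g • (p.2 : Y) ∈ F :=
  ⟨fun g hg h hh => by_contra fun H => hp (Or.inl ⟨g, hg, h, hh, H⟩),
    fun g hg => by_contra fun H => hp (Or.inr ⟨g, hg, H⟩)⟩

/-- Cancel `φ 1` in `φ (1 * 1) x = φ 1 (φ 1 x)`. -/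
theorem map_one_of_notMem_modelBad (hφ : Function.Injective (φ 1)) {L : Finset G} (hL1 : 1 ∈ L)
    {p : X × F} (hp : p ∉ modelBad φ F L) : φ 1 p.1 = p.1 := by
  have h := ((of_notMem_modelBad hp).1 1 hL1 1 hL1).1
  rw [mul_one] at h
  exact (hφ h).symm

/-- For `n` outside, both sides are `m * n * u y` in `B`. For `n` a unit and `m` outside,
equivariance `hu` is what matches them. -/
theorem modelAct_mul (hι : Function.Injective ι) (hφ : Function.Injective (φ 1))
    (hideal : ∀ s t : M, s * t ∈ Set.range ι → s ∈ Set.range ι ∧ t ∈ Set.range ι)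
    {L : Finset G} (hL1 : 1 ∈ L) {m n : M}
    (hLm : ∀ g, ι g = m → g ∈ L) (hLn : ∀ g, ι g = n → g ∈ L) (hLmn : ∀ g, ι g = m * n → g ∈ L)
    (hBn : n ∉ Set.range ι → ∀ y : F, n * ι (u y) ∈ B)
    (hBm : m ∉ Set.range ι → ∀ y : F, m * ι (u y) ∈ B)
    (hBmn : m * n ∉ Set.range ι → ∀ y : F, m * n * ι (u y) ∈ B)
    (hu : m ∉ Set.range ι → ∀ g (y : Y), m * ι (u (g • y)) = m * ι (g * u y))
    {p : X × F} (hp : p ∉ modelBad φ F L) (c : C) :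
    modelAct ι φ F B u m (modelAct ι φ F B u n (.inl (p, c))) =
      modelAct ι φ F B u (m * n) (.inl (p, c)) := by
  have hx1 := map_one_of_notMem_modelBad hφ hL1 hp
  obtain ⟨hp1, hp2⟩ := of_notMem_modelBad hp
  obtain ⟨x, y⟩ := p
  dsimp only at hx1 hp1 hp2
  by_cases hm1 : m = 1
  · simp [hm1, modelAct_one]
  by_cases hn : n ∈ Set.range ι
  · obtain ⟨h, rfl⟩ := hn
    have hhL := hLn h rfl
    rw [modelAct_unit hι c (fun _ => hx1) (hp2 h hhL)]
    by_cases hm : m ∈ Set.range ι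
    · obtain ⟨g, rfl⟩ := hm
      have hgh := hp2 _ (hLmn (g * h) (map_mul ι g h))
      rw [modelAct_unit hι c (fun hg => absurd (by rw [hg, map_one]) hm1)
        (by simpa only [mul_smul] using hgh), ← map_mul,
        modelAct_unit hι c (fun _ => hx1) hgh, (hp1 g (hLm g rfl) h hhL).1]
      simp only [mul_smul]
    · have hmn : m * ι h ∉ Set.range ι := fun H => hm (hideal _ _ H).1
      rw [modelAct_outside hm _ _ c (hBm hm ⟨_, hp2 h hhL⟩),
        modelAct_outside hmn x y c (hBmn hmn y)]
      simp only [hu hm h y, map_mul, mul_assoc]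
  · have hmn : m * n ∉ Set.range ι := fun h => hn (hideal _ _ h).2
    have hb := hBmn hmn y
    rw [modelAct_outside hn x y c (hBn hn y), modelAct_outside hmn x y c hb,
      modelAct_inr _ (by rwa [← mul_assoc])]
    simp only [mul_assoc]

/-- Units are separated by `φ`, units from outside elements by the summand, and outside elements by
cancelling the unit `u y`. -/
theorem modelAct_ne (hι : Function.Injective ι) (hφ : Function.Injective (φ 1))
    {L : Finset G} (hL1 : 1 ∈ L) {m n : M} (hmn : m ≠ n)
    (hLm : ∀ g, ι g = m → g ∈ L) (hLn : ∀ g, ι g = n → g ∈ L)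
    (hBm : m ∉ Set.range ι → ∀ y : F, m * ι (u y) ∈ B)
    (hBn : n ∉ Set.range ι → ∀ y : F, n * ι (u y) ∈ B)
    {p : X × F} (hp : p ∉ modelBad φ F L) (c : C) :
    modelAct ι φ F B u m (.inl (p, c)) ≠ modelAct ι φ F B u n (.inl (p, c)) := by
  have hx1 := map_one_of_notMem_modelBad hφ hL1 hp
  obtain ⟨hp1, hp2⟩ := of_notMem_modelBad hp
  obtain ⟨x, y⟩ := p
  dsimp only at hx1 hp1 hp2
  by_cases hm : m ∈ Set.range ι <;> by_cases hn : n ∈ Set.range ι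
  · obtain ⟨g, rfl⟩ := hm
    obtain ⟨h, rfl⟩ := hn
    rw [modelAct_unit hι c (fun _ => hx1) (hp2 g (hLm g rfl)),
      modelAct_unit hι c (fun _ => hx1) (hp2 h (hLn h rfl))]
    intro H
    simp only [Sum.inl.injEq, Prod.mk.injEq] at H
    exact (hp1 g (hLm g rfl) h (hLn h rfl)).2 (fun e => hmn (by rw [e])) H.1.1
  · obtain ⟨g, rfl⟩ := hm
    rw [modelAct_unit hι c (fun _ => hx1) (hp2 g (hLm g rfl)),
      modelAct_outside hn x y c (hBn hn y)]
    exact Sum.inl_ne_inr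
  · obtain ⟨h, rfl⟩ := hn
    rw [modelAct_unit hι c (fun _ => hx1) (hp2 h (hLn h rfl)),
      modelAct_outside hm x y c (hBm hm y)]
    exact Sum.inr_ne_inl
  · rw [modelAct_outside hm x y c (hBm hm y), modelAct_outside hn x y c (hBn hn y)]
    intro H
    have H' : m * ι (u y) = n * ι (u y) := congrArg Subtype.val (Sum.inr.inj H)
    have h1 : ι (u y) * ι (u y)⁻¹ = 1 := by rw [← map_mul, mul_inv_cancel, map_one]
    exact hmn (by simpa [mul_assoc, h1] using congrArg (· * ι (u y)⁻¹) H')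

end Model

/-! ### Negligibility of `B` and assembly -/

/-- Blowing up a finite set makes a fixed finite set adjoined to it negligible. -/
theorem exists_ncard_sum_le {A B : Type*} [Finite A] [Nonempty A] [Finite B] (W : Set A) {ε : ℝ}
    (hε : 0 < ε) (hW : (W.ncard : ℝ) ≤ ε / 2 * Nat.card A) :
    ∃ N : ℕ, 0 < N ∧
      ((Sum.inl '' (Prod.fst ⁻¹' W) ∪ Set.range Sum.inr : Set (A × Fin N ⊕ B)).ncard : ℝ) ≤
        ε * Nat.card (A × Fin N ⊕ B) := by
  obtain ⟨N, hN⟩ := exists_nat_gt (2 * (Nat.card B : ℝ) / ε)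
  have hNpos : (0 : ℝ) < N := lt_of_le_of_lt (by positivity) hN
  refine ⟨N, by exact_mod_cast hNpos, ?_⟩
  have h1 := ncard_preimage_fst_le (Y := Fin N) W hW
  rw [div_lt_iff₀ hε] at hN
  have hA : (1 : ℝ) ≤ Nat.card A := by exact_mod_cast Nat.card_pos
  refine (Nat.cast_le.2 (Set.ncard_union_le _ _)).trans ?_
  rw [Set.ncard_image_of_injective _ Sum.inl_injective, ← Set.image_univ,
    Set.ncard_image_of_injective _ Sum.inr_injective, Set.ncard_univ, Nat.card_sum]
  rw [Nat.card_prod, Nat.card_fin] at h1 ⊢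
  push_cast at h1 ⊢
  have h2 : ε * N ≤ ε * (Nat.card A * N) :=
    mul_le_mul_of_nonneg_left (le_mul_of_one_le_left hNpos.le hA) hε.le
  have h3 : 0 ≤ ε * Nat.card B := by positivity
  linarith

theorem theorem3p1 {M : Type*} [Monoid M] {G : Type*} [Group G]
    (ι : G →* M) (hι : Function.Injective ι)
    (hJ : Set.range ι = greenJClass (1 : M))
    (hsofic : IsSoficGroup G)
    (hloc : IsLocallyAmenable G (Outside ι)) :
    IsSoficMonoid M := by
  classical
  intro K ε hε
  have hideal : ∀ s t : M, s * t ∈ Set.range ι → s ∈ Set.range ι ∧ t ∈ Set.range ι := by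
    rw [hJ]
    exact fun s t => mem_greenJClass_one_of_mul
  -- Products are included because multiplicativity on `K` also involves the action of `m * n`.
  let K' : Finset M := insert 1 (K ∪ K * K)
  have hKK' : K ⊆ K' := fun m hm => Finset.mem_insert_of_mem (Finset.mem_union_left _ hm)
  have hKmul : ∀ m ∈ K, ∀ n ∈ K, m * n ∈ K' := fun m hm n hn =>
    Finset.mem_insert_of_mem (Finset.mem_union_right _ (Finset.mul_mem_mul hm hn))
  let L : Finset G := K'.preimage ι hι.injOn
  have hL : ∀ m ∈ K', ∀ g, ι g = m → g ∈ L := fun m hm g hg =>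
    Finset.mem_preimage.2 (hg ▸ hm)
  have hL1 : (1 : G) ∈ L := hL 1 (Finset.mem_insert_self _ _) 1 (map_one ι)
  let I := {s : Outside ι // s.1 ∈ K'}
  have : Finite I := Finite.of_injective (fun s : I => (⟨s.1.1, s.2⟩ : K'))
    fun s t h => Subtype.ext (Subtype.ext (Subtype.mk.inj h))
  let H : I → Subgroup G := fun s => orbitStabiliser G s.1
  have : ∀ i, (H i).Normal := fun i => orbitStabiliser_normal G i.1
  obtain ⟨u, hu⟩ := exists_equivariant_pi H
  -- Sofic and Følner errors of `ε / 4` each give `ε / 2`; the other half is left for `B`.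
  obtain ⟨X, _, _, φ, hφ⟩ := hsofic.exists_almost_hom L (show 0 < ε / 4 by positivity)
  obtain ⟨F, hFfin, hFne, hF⟩ :=
    exists_almost_invariant_pi H (fun i => hloc i.1) L (show 0 < ε / 4 by positivity)
  have : Finite F := hFfin
  have : Nonempty F := hFne.to_subtype
  let B : Set M := Set.range fun p : K' × F => p.1.1 * ι (u p.2)
  have hB : ∀ m ∈ K', ∀ y : F, m * ι (u y) ∈ B := fun m hm y => ⟨(⟨m, hm⟩, y), rfl⟩
  have hW : ((modelBad (fun g => φ g) F L).ncard : ℝ) ≤ ε / 2 * Nat.card (X × F) := by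
    have h1 := ncard_preimage_fst_le (Y := F) _ hφ
    have h2 := ncard_preimage_snd_le (X := X) _ hF
    have h3 : ((modelBad (fun g => φ g) F L).ncard : ℝ) ≤ _ :=
      Nat.cast_le.2 (Set.ncard_union_le _ _)
    rw [Nat.cast_add] at h3
    refine h3.trans ((add_le_add h1 h2).trans (le_of_eq ?_))
    ring
  obtain ⟨N, hN, hbad⟩ := exists_ncard_sum_le (B := B) _ hε hW
  have : NeZero N := ⟨hN.ne'⟩
  refine IsSoficMonoid.of_ncard_bad_le K (modelAct ι (fun g => φ g) F B u) _ hbad modelAct_one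
    (fun m hm n hn z hz => ?_) (fun m hm n hn hmn z hz => ?_)
  all_goals
    obtain ⟨p, c⟩ | b := z
    swap
    · exact absurd (Or.inr ⟨b, rfl⟩) hz
    have hp : p ∉ modelBad (fun g => φ g) F L := fun h => hz (Or.inl ⟨(p, c), h, rfl⟩)
  · exact modelAct_mul hι (φ 1).injective hideal hL1 (hL m (hKK' hm)) (hL n (hKK' hn))
      (hL _ (hKmul m hm n hn)) (fun _ => hB n (hKK' hn)) (fun _ => hB m (hKK' hm))
      (fun _ => hB _ (hKmul m hm n hn))
      (fun hm' g y => mul_eq_mul_of_mem_orbitStabiliser ι ⟨m, hm'⟩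
        (hu g y ⟨⟨m, hm'⟩, hKK' hm⟩)) hp c
  · exact modelAct_ne hι (φ 1).injective hL1 hmn (hL m (hKK' hm)) (hL n (hKK' hn))
      (fun _ => hB m (hKK' hm)) (fun _ => hB n (hKK' hn)) hp c
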